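/- Let $f_1,\dots,f_m$ and $c_j$ ($j\in\mathcal I$, with $\mathcal I$ a finite set) be real polynomials in $x=(x_1,\dots,x_n)$, and let $f=(f_1,\dots,f_m)$. Let $$K=\{x\in\mathbb R^n : c_j(x)\ge 0 \text{ for all } j\in\mathcal I\}$$ (so there are no equality constraints), and $$\mathcal U=\{u\in\mathbb R^m : \text{there is } x\in K \text{ with } u_i\ge f_i(x) \text{ for all } i=1,\dots,m\}.$$ A polynomial $p$ is called SOS-convex if its Hessian can be written as $\nabla^2p=Q(x)^TQ(x)$ for some matrix polynomial $Q$. A vector $v\in\mathbb R^m$ is called a weakly Pareto value if $v=f(x^*)$ for some $x^*\in K$ such that there is no $x\in K$ with $f_i(x)<f_i(x^*)$ for all $i=1,\dots,m$. Let $d$ be the maximum of the degrees of $f_1,\dots,f_m$ and let $$d_0=\max\bigl\{\lceil d/2\rceil,\ \lceil \deg(c_j)/2\rceil\ (j\in\mathcal I)\bigr\}$$ (the zero polynomial is given degree $0$). For a nonnegative integer $k$, let $\mathbb N^n_k$ be the set of exponents $\alpha\in\mathbb N^n$ with $|\alpha|=\alpha_1+\dots+\alpha_n\le k$. For $y=(y_\alpha)\in\mathbb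 R^{\mathbb N^n_{2d_0}}$ and a polynomial $p=\sum_\alpha p_\alpha x^\alpha$ of degree at most $2d_0$, write $\langle p,y\rangle=\sum_{\alpha}p_\alpha y_\alpha$, and let $M_{d_0}[y]=(y_{\alpha+\beta})_{\alpha,\beta\in\mathbb N^n_{d_0}}$ be the moment matrix of $y$. Let $\mathcal V_1$ be the set of all $v\in\mathbb R^m$ for which there exists $y\in\mathbb R^{\mathbb N^n_{2d_0}}$ such that $$\langle c_j,y\rangle\ge 0\ (j\in\mathcal I),\qquad v_i>\langle f_i,y\rangle\ (i=1,\dots,m),\qquad y_0=1,\qquad M_{d_0}[y]\succeq 0.$$ Assume that $K$ has nonempty interior and that all $f_i$ and all $-c_j$ ($j\in\mathcal I$) are SOS-convex. Then the interior of $\mathcal U$ is equal to $\mathcal V_1$. Moreover, a vector $v\in f(K)$ is a weakly Pareto value if and only if $v$ lies on the boundary of the closure $\mathrm{cl}(\mathcal V_1)$. -/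

import Mathlib

noncomputable section

namespace PolyMOP

/-- The set of exponents `α ∈ ℕⁿ` with `|α| = α₁ + ⋯ + αₙ ≤ d`. -/
abbrev MultiIdx (n d : ℕ) : Type := {α : Fin n →₀ ℕ // α.degree ≤ d}

instance (n d : ℕ) : Fintype (MultiIdx n d) :=
  (Finsupp.finite_of_degree_le (σ := Fin n) d).fintype

/-- Truncated multi-sequences of degree `d`: real vectors labelled by the exponents `|α| ≤ d`. -/
abbrev Tms (n d : ℕ) : Type := MultiIdx n d → ℝ

/-- The pairing `⟨p, y⟩ = ∑_α p_α y_α`, for `p` of degree at most `d`. -/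
def pairing {n d : ℕ} (p : MvPolynomial (Fin n) ℝ) (y : Tms n d) : ℝ :=
  ∑ α : MultiIdx n d, p.coeff α.1 * y α

/-- The sum of two exponents of degree at most `k`. -/
def addIdx {n k : ℕ} (α β : MultiIdx n k) : MultiIdx n (2 * k) :=
  ⟨α.1 + β.1, by
    have h1 := α.2
    have h2 := β.2
    rw [map_add]
    omega⟩

/-- The zero exponent, labelling the entry `y₀` of a truncated multi-sequence. -/
def zeroIdx (n d : ℕ) : MultiIdx n d := ⟨0, by simp⟩

/-- The `k`-th moment matrix `M_k[y]`, whose `(α, β)` entry is `y_{α+β}`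
(`|α|, |β| ≤ k`). -/
def momentMatrix {n k : ℕ} (y : Tms n (2 * k)) : Matrix (MultiIdx n k) (MultiIdx n k) ℝ :=
  Matrix.of fun α β => y (addIdx α β)

/-- The Hessian `∇²p`, as a matrix of polynomials. -/
def hessian {n : ℕ} (p : MvPolynomial (Fin n) ℝ) :
    Matrix (Fin n) (Fin n) (MvPolynomial (Fin n) ℝ) :=
  Matrix.of fun i j => MvPolynomial.pderiv i (MvPolynomial.pderiv j p)

/-- `p` is SOS-convex: `∇²p = Q(x)ᵀ Q(x)` for some (rectangular) matrix polynomial `Q`. -/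
def IsSOSConvex {n : ℕ} (p : MvPolynomial (Fin n) ℝ) : Prop :=
  ∃ (r : ℕ) (Q : Matrix (Fin r) (Fin n) (MvPolynomial (Fin n) ℝ)),
    hessian p = Q.transpose * Q

/-- The feasible set `K = {x ∈ ℝⁿ | c_j(x) ≥ 0 for all j}`. -/
def feasibleSet {n : ℕ} {J : Type*} (c : J → MvPolynomial (Fin n) ℝ) : Set (Fin n → ℝ) :=
  {x | ∀ j, 0 ≤ MvPolynomial.eval x (c j)}

/-- The objective vector `f(x) = (f₁(x), …, f_m(x))`. -/
def objective {n m : ℕ} (f : Fin m → MvPolynomial (Fin n) ℝ) (x : Fin n → ℝ) : Fin m → ℝ :=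
  fun i => MvPolynomial.eval x (f i)

/-- The epigraph set `U = {u | u_i ≥ f_i(x) for all i, for some x ∈ K}`. -/
def epigraphSet {n m : ℕ} (f : Fin m → MvPolynomial (Fin n) ℝ) (K : Set (Fin n → ℝ)) :
    Set (Fin m → ℝ) :=
  {u | ∃ x ∈ K, ∀ i, objective f x i ≤ u i}

/-- `p` is a weakly Pareto point of `min f` over `K`: it is feasible, and no feasible point is
strictly better in every objective. -/
def IsWeaklyParetoPoint {n m : ℕ} (f : Fin m → MvPolynomial (Fin n) ℝ) (K : Set (Fin n → ℝ))
    (p : Fin n → ℝ) : Prop :=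
  p ∈ K ∧ ¬ ∃ x ∈ K, ∀ i, objective f x i < objective f p i

/-- `v` is a weakly Pareto value: the objective vector at a weakly Pareto point. -/
def IsWeaklyParetoValue {n m : ℕ} (f : Fin m → MvPolynomial (Fin n) ℝ) (K : Set (Fin n → ℝ))
    (v : Fin m → ℝ) : Prop :=
  ∃ p, IsWeaklyParetoPoint f K p ∧ v = objective f p

/-- The maximum degree `d` of the objectives. -/
def maxObjDegree {n m : ℕ} (f : Fin m → MvPolynomial (Fin n) ℝ) : ℕ :=
  Finset.univ.sup fun i => (f i).totalDegree

/-- The relaxation order `d₀ = max {⌈d/2⌉, ⌈deg(c_j)/2⌉ (j ∈ J)}`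
(`a ⌈/⌉ b` is division of natural numbers, rounded up). -/
def relaxOrder {n m : ℕ} {J : Type*} [Fintype J] (f : Fin m → MvPolynomial (Fin n) ℝ)
    (c : J → MvPolynomial (Fin n) ℝ) : ℕ :=
  max (maxObjDegree f ⌈/⌉ 2) (Finset.univ.sup fun j => (c j).totalDegree ⌈/⌉ 2)

/-- The set `V₁` of all `v ∈ ℝᵐ` for which some truncated multi-sequence `y` of degree `2 d₀`
satisfies `⟨c_j, y⟩ ≥ 0`, `v_i > ⟨f_i, y⟩`, `y₀ = 1` and `M_{d₀}[y] ⪰ 0`. -/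
def sdpSet {n m : ℕ} {J : Type*} [Fintype J] (f : Fin m → MvPolynomial (Fin n) ℝ)
    (c : J → MvPolynomial (Fin n) ℝ) : Set (Fin m → ℝ) :=
  {v | ∃ y : Tms n (2 * relaxOrder f c),
    (∀ j, 0 ≤ pairing (c j) y) ∧ (∀ i, pairing (f i) y < v i) ∧
    y (zeroIdx n _) = 1 ∧ (momentMatrix y).PosSemidef}

end PolyMOP

end

/-! Both claims reduce to identifying `sdpSet f c` with the strict epigraph {v : f(x) < v for some x
∈ K}. A point x of K yields its Dirac moments. Conversely, a feasible y yields its vector x of first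
moments, by Jensen's inequality `exists_eval_le_pairing` for the f_i and the -c_j. For Jensen, let L
= ⟨·, y⟩ and φ(t) = L(p(x + t(z - x))), with z the variable of p. SOS-convexity makes φ'' the value
of L at a sum of squares, hence nonnegative; φ'(0) = 0 since L(z - x) = 0; so p(x) = φ(0) ≤ φ(1) =
⟨p, y⟩. The rest is topology: the strict epigraph is open, and is the interior both of 𝒰 and of its
own closure. -/

namespace PolyMOP

open MvPolynomial

/-! ### Degree bounds for sums of squares and substitutions -/

section Degree

variable {σ : Type*}

/-- The top-degree homogeneous component is multiplicative. -/
theorem homogeneousComponent_add_mul {p q : MvPolynomial σ ℝ} {a b : ℕ}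
    (hp : p.totalDegree ≤ a) (hq : q.totalDegree ≤ b) :
    homogeneousComponent (a + b) (p * q) =
      homogeneousComponent a p * homogeneousComponent b q := by
  classical
  ext d
  by_cases hd : d.degree = a + b
  · rw [coeff_homogeneousComponent, if_pos hd, coeff_mul, coeff_mul]
    refine Finset.sum_congr rfl fun ij hij => ?_
    have hsum : ij.1.degree + ij.2.degree = a + b := by
      rw [← map_add, Finset.HasAntidiagonal.mem_antidiagonal.1 hij, hd]
    rw [coeff_homogeneousComponent, coeff_homogeneousComponent]
    have key : ∀ {r : MvPolynomial σ ℝ} {m : σ →₀ ℕ} {e : ℕ}, r.totalDegree ≤ e →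
        e < m.degree → coeff m r = 0 := fun hr hm =>
      coeff_eq_zero_of_totalDegree_lt (by
        have := lt_of_le_of_lt hr hm
        rwa [Finsupp.degree_apply] at this)
    rcases lt_trichotomy ij.1.degree a with h | h | h
    · rw [key hq (by omega : b < ij.2.degree)]; simp
    · rw [if_pos h, if_pos (by omega)]
    · rw [key hp h]; simp
  · rw [coeff_homogeneousComponent, if_neg hd]
    exact (((homogeneousComponent_isHomogeneous a p).mul
      (homogeneousComponent_isHomogeneous b q)).coeff_eq_zero hd).symm

/-- The summands of a sum of squares of degree at most `2 * k` have degree at most `k`. -/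
theorem totalDegree_le_of_sum_mul_self {ι : Type*} [Fintype ι] {q : ι → MvPolynomial σ ℝ} {k : ℕ}
    (h : (∑ i, q i * q i).totalDegree ≤ 2 * k) (i : ι) : (q i).totalDegree ≤ k := by
  set D := Finset.univ.sup fun i => (q i).totalDegree with hD
  have hle : ∀ i, (q i).totalDegree ≤ D := fun i =>
    Finset.le_sup (f := fun i => (q i).totalDegree) (Finset.mem_univ i)
  refine (hle i).trans ?_
  by_contra! hk
  -- As 2D > 2k, the degree-2D part of the sum vanishes; it is the sum of squares of the degree-D
  -- parts, so over ℝ each of these is zero.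
  have hsum : ∑ i, homogeneousComponent D (q i) * homogeneousComponent D (q i) = 0 := by
    rw [← homogeneousComponent_eq_zero (D + D) (∑ i, q i * q i) (by omega), map_sum]
    exact Finset.sum_congr rfl fun i _ => (homogeneousComponent_add_mul (hle i) (hle i)).symm
  have hzero : ∀ i, homogeneousComponent D (q i) = 0 := fun i => by
    refine MvPolynomial.funext fun x => ?_
    have hx := congrArg (eval x) hsum
    simp only [map_sum, map_mul, map_zero] at hx
    simpa using (Finset.sum_eq_zero_iff_of_nonneg fun j _ => mul_self_nonneg _).1 hx i
      (Finset.mem_univ i)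
  obtain ⟨j, -, hj⟩ := Finset.exists_mem_eq_sup Finset.univ ⟨i, Finset.mem_univ i⟩
    fun i => (q i).totalDegree
  have hj0 : q j ≠ 0 := by
    intro h0
    rw [← hD, h0, totalDegree_zero] at hj
    omega
  obtain ⟨s, hs, hsD⟩ := Finset.exists_mem_eq_sup (q j).support
    (support_nonempty.2 hj0) fun s => s.sum fun _ e => e
  have hc := congrArg (coeff s) (hzero j)
  rw [coeff_homogeneousComponent, if_pos, coeff_zero] at hc
  · exact mem_support_iff.1 hs hc
  · rw [hD, hj, totalDegree, hsD]
    exact (Finsupp.degree_apply s)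

theorem totalDegree_pderiv_le (i : σ) (p : MvPolynomial σ ℝ) :
    (pderiv i p).totalDegree ≤ p.totalDegree - 1 := by
  refine Finset.sup_le fun m hm => ?_
  rw [mem_support_iff, coeff_pderiv] at hm
  have h := le_totalDegree (mem_support_iff.2 (left_ne_zero_of_mul hm))
  change m.degree ≤ _
  change (m + Finsupp.single i 1).degree ≤ _ at h
  rw [map_add, Finsupp.degree_single] at h
  omega

theorem totalDegree_aeval_le {τ : Type*} {g : σ → MvPolynomial τ ℝ}
    (hg : ∀ i, (g i).totalDegree ≤ 1) (p : MvPolynomial σ ℝ) :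
    (aeval g p).totalDegree ≤ p.totalDegree := by
  rw [aeval_def, eval₂_eq]
  refine totalDegree_finsetSum_le fun d hd => ?_
  refine (totalDegree_mul _ _).trans ?_
  rw [algebraMap_eq, totalDegree_C, zero_add]
  refine (totalDegree_finsetProd _ _).trans (le_trans ?_ (le_totalDegree hd))
  refine Finset.sum_le_sum fun i _ => (totalDegree_pow _ _).trans ?_
  simpa using Nat.mul_le_mul_left (d i) (hg i)

end Degree

/-! ### Contraction towards a point and its derivative in t -/

section Affine

variable {n : ℕ}

/-- The substitution `z ↦ x + t (z - x)`. -/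
noncomputable def contract (x : Fin n → ℝ) (t : ℝ) :
    MvPolynomial (Fin n) ℝ →ₐ[ℝ] MvPolynomial (Fin n) ℝ :=
  aeval fun i => C (x i) + t • (X i - C (x i))

theorem contract_zero (x : Fin n → ℝ) (p : MvPolynomial (Fin n) ℝ) :
    contract x 0 p = C (eval x p) := by
  induction p using MvPolynomial.induction_on with
  | C a => simp [contract, algebraMap_eq]
  | add p q hp hq => simp [hp, hq]
  | mul_X p i hp => rw [map_mul, hp]; simp [contract]

theorem contract_one (x : Fin n → ℝ) (p : MvPolynomial (Fin n) ℝ) : contract x 1 p = p := by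
  simp [contract]

theorem totalDegree_X_sub_C_le (i : Fin n) (a : ℝ) :
    (X i - C a : MvPolynomial (Fin n) ℝ).totalDegree ≤ 1 :=
  (totalDegree_sub_C_le _ _).trans (totalDegree_X i).le

theorem totalDegree_contract_le (x : Fin n → ℝ) (t : ℝ) (p : MvPolynomial (Fin n) ℝ) :
    (contract x t p).totalDegree ≤ p.totalDegree := by
  refine totalDegree_aeval_le (fun i => (totalDegree_add _ _).trans (max_le ?_ ?_)) p
  · simp
  · exact (totalDegree_smul_le _ _).trans (totalDegree_X_sub_C_le i _)

/-- Chain rule under a linear functional. `L` is arbitrary so that the product step can absorb the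
factor `X j - C (x j)` into it. -/
theorem hasDerivAt_contract (x : Fin n → ℝ) (p : MvPolynomial (Fin n) ℝ)
    (L : MvPolynomial (Fin n) ℝ →ₗ[ℝ] ℝ) (t : ℝ) :
    HasDerivAt (fun s => L (contract x s p))
      (L (∑ i, contract x t (pderiv i p) * (X i - C (x i)))) t := by
  induction p using MvPolynomial.induction_on generalizing L with
  | C a => simpa [contract] using hasDerivAt_const t _
  | add p q hp hq =>
    simp only [map_add, add_mul, Finset.sum_add_distrib]
    exact (hp L).fun_add (hq L)
  | mul_X p j hp =>
    have h1 := (hp L).const_mul (x j)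
    have h2 := (hasDerivAt_id' t).fun_mul (hp (L ∘ₗ LinearMap.mulRight ℝ (X j - C (x j))))
    have hfun : ∀ s, contract x s (p * X j) = x j • contract x s p +
        s • (contract x s p * (X j - C (x j))) := fun s => by
      rw [map_mul, smul_eq_C_mul, smul_eq_C_mul]
      simp only [contract, aeval_X, smul_eq_C_mul]
      ring
    simp only [hfun, map_add, map_smul, smul_eq_mul]
    refine (h1.fun_add h2).congr_deriv ?_
    have hsum' : ∑ i, contract x t (pderiv i (p * X j)) * (X i - C (x i)) =
        x j • (∑ i, contract x t (pderiv i p) * (X i - C (x i))) +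
        (contract x t p * (X j - C (x j)) +
        t • ((∑ i, contract x t (pderiv i p) * (X i - C (x i))) * (X j - C (x j)))) := by
      have hX : contract x t (X j) = C (x j) + C t * (X j - C (x j)) := by
        simp [contract, smul_eq_C_mul]
      have hsum : ∀ i, contract x t (pderiv i (p * X j)) * (X i - C (x i)) =
          (contract x t (pderiv i p) * (X i - C (x i))) * (C (x j) + C t * (X j - C (x j))) +
          if i = j then contract x t p * (X j - C (x j)) else 0 := fun i => by
        rw [pderiv_mul, map_add, map_mul, map_mul, hX, pderiv_X]
        rcases eq_or_ne i j with rfl | h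
        · simp; ring
        · simp [h, Ne.symm h]; ring
      rw [Finset.sum_congr rfl fun i _ => hsum i, Finset.sum_add_distrib, ← Finset.sum_mul,
        smul_eq_C_mul, smul_eq_C_mul]
      simp
      ring
    rw [hsum', map_add, map_add, map_smul, map_smul]
    simp only [LinearMap.comp_apply, LinearMap.mulRight_apply, smul_eq_mul, one_mul]

end Affine

/-! ### Riesz functional and moment matrices -/

section Moments

variable {n k : ℕ}

/-- The Riesz functional `p ↦ ⟨p, y⟩`. -/
noncomputable def riesz {d : ℕ} (y : Tms n d) : MvPolynomial (Fin n) ℝ →ₗ[ℝ] ℝ where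
  toFun p := pairing p y
  map_add' p q := by simp [pairing, add_mul, Finset.sum_add_distrib]
  map_smul' a p := by simp [pairing, Finset.mul_sum, mul_assoc]

theorem riesz_apply {d : ℕ} (y : Tms n d) (p : MvPolynomial (Fin n) ℝ) :
    riesz y p = pairing p y := rfl

theorem pairing_monomial {d : ℕ} (y : Tms n d) (α : MultiIdx n d) (a : ℝ) :
    pairing (monomial α.1 a) y = a * y α := by
  classical
  unfold pairing
  rw [Finset.sum_eq_single α]
  · simp
  · intro β _ h
    rw [coeff_monomial, if_neg fun e => h (Subtype.ext e.symm), zero_mul]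
  · simp

theorem sum_monomial_eq {d : ℕ} {p : MvPolynomial (Fin n) ℝ} (hp : p.totalDegree ≤ d) :
    ∑ α : MultiIdx n d, monomial α.1 (p.coeff α.1) = p := by
  classical
  ext s
  rw [coeff_sum]
  simp only [coeff_monomial]
  by_cases hs : s.degree ≤ d
  · rw [Finset.sum_eq_single ⟨s, hs⟩]
    · simp
    · intro β _ h
      rw [if_neg fun e => h (Subtype.ext e)]
    · simp
  · rw [Finset.sum_eq_zero fun β _ => if_neg fun (e : β.1 = s) => hs (e ▸ β.2), eq_comm]
    exact notMem_support_iff.1 fun h => hs ((le_totalDegree h).trans hp)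

theorem pairing_C {d : ℕ} (y : Tms n d) (hy : y (zeroIdx n d) = 1) (a : ℝ) :
    pairing (C a) y = a := by
  exact (pairing_monomial y (zeroIdx n d) a).trans (by rw [hy, mul_one])

/-- The pairing is the quadratic form of the moment matrix at the coefficient vector of `q`. -/
theorem pairing_mul_self_nonneg {y : Tms n (2 * k)} (hy : (momentMatrix y).PosSemidef)
    {q : MvPolynomial (Fin n) ℝ} (hq : q.totalDegree ≤ k) : 0 ≤ pairing (q * q) y := by
  have h := hy.dotProduct_mulVec_nonneg fun α => q.coeff α.1
  have key : pairing (q * q) y = ∑ α : MultiIdx n k, ∑ β : MultiIdx n k,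
      q.coeff α.1 * (y (addIdx α β) * q.coeff β.1) := by
    conv_lhs => rw [← sum_monomial_eq hq, ← riesz_apply, Finset.sum_mul_sum]
    simp only [map_sum, monomial_mul, riesz_apply]
    refine Finset.sum_congr rfl fun α _ => Finset.sum_congr rfl fun β _ => ?_
    rw [show α.1 + β.1 = (addIdx α β).1 from rfl, pairing_monomial]
    ring
  rw [key]
  simpa [dotProduct, Matrix.mulVec, momentMatrix, Finset.mul_sum] using h

/-- The moment sequence of the Dirac measure at `x`. -/
noncomputable def diracTms (d : ℕ) (x : Fin n → ℝ) : Tms n d := fun α => eval x (monomial α.1 1)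

theorem pairing_diracTms {d : ℕ} (x : Fin n → ℝ) {p : MvPolynomial (Fin n) ℝ}
    (hp : p.totalDegree ≤ d) : pairing p (diracTms d x) = eval x p := by
  conv_rhs => rw [← sum_monomial_eq hp]
  rw [map_sum, pairing]
  refine Finset.sum_congr rfl fun α _ => ?_
  simp [diracTms, eval_monomial]

theorem posSemidef_momentMatrix_diracTms (x : Fin n → ℝ) :
    (momentMatrix (diracTms (2 * k) x)).PosSemidef := by
  have h : momentMatrix (diracTms (2 * k) x) =
      Matrix.vecMulVec (diracTms k x) (star (diracTms k x)) := by
    ext α β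
    simp only [momentMatrix, Matrix.of_apply, Matrix.vecMulVec_apply, diracTms, star_trivial,
      ← map_mul, monomial_mul, mul_one]
    rfl
  rw [h]
  exact Matrix.posSemidef_vecMulVec_self_star _

end Moments

/-! ### Jensen's inequality for SOS-convex polynomials -/

section Jensen

variable {n k : ℕ}

/-- The second derivative along `z ↦ x + t (z - x)` of an SOS-convex polynomial is a sum of
squares, so positive semidefinite moment matrices make it nonnegative. -/
theorem pairing_hessian_nonneg (hk : 1 ≤ k) {y : Tms n (2 * k)}
    (hy : (momentMatrix y).PosSemidef) {p : MvPolynomial (Fin n) ℝ} (hp : IsSOSConvex p)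
    (hdeg : p.totalDegree ≤ 2 * k) (x : Fin n → ℝ) (t : ℝ) :
    0 ≤ pairing (∑ i, ∑ j, contract x t (pderiv j (pderiv i p)) * (X j - C (x j)) *
      (X i - C (x i))) y := by
  obtain ⟨r, Q, hQ⟩ := hp
  set q : Fin r → MvPolynomial (Fin n) ℝ :=
    fun l => ∑ i, contract x t (Q l i) * (X i - C (x i)) with hq
  have hsum : ∑ i, ∑ j, contract x t (pderiv j (pderiv i p)) * (X j - C (x j)) *
      (X i - C (x i)) = ∑ l, q l * q l := by
    have hess : ∀ i j, pderiv j (pderiv i p) = ∑ l, Q l j * Q l i := fun i j => by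
      have := congrFun (congrFun hQ j) i
      simpa [hessian, Matrix.mul_apply] using this
    simp only [hess, hq, map_sum, map_mul, Finset.sum_mul, Finset.mul_sum]
    rw [Finset.sum_congr rfl fun i _ => Finset.sum_comm, Finset.sum_comm]
    refine Finset.sum_congr rfl fun l _ => ?_
    rw [Finset.sum_comm]
    refine Finset.sum_congr rfl fun i _ => Finset.sum_congr rfl fun j _ => ?_
    ring
  have hdq : (∑ l, q l * q l).totalDegree ≤ 2 * k := by
    rw [← hsum]
    refine totalDegree_finsetSum_le fun i _ => totalDegree_finsetSum_le fun j _ => ?_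
    -- With truncated subtraction these bounds give max(deg p, 2), so `1 ≤ k` is needed.
    have h1 := totalDegree_contract_le x t (pderiv j (pderiv i p))
    have h2 := totalDegree_pderiv_le j (pderiv i p)
    have h3 := totalDegree_pderiv_le i p
    have h4 := totalDegree_X_sub_C_le i (x i)
    have h5 := totalDegree_X_sub_C_le j (x j)
    have h6 := totalDegree_mul (contract x t (pderiv j (pderiv i p)) * (X j - C (x j)))
      (X i - C (x i))
    have h7 := totalDegree_mul (contract x t (pderiv j (pderiv i p))) (X j - C (x j))
    omega
  rw [hsum, ← riesz_apply, map_sum]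
  exact Finset.sum_nonneg fun l _ =>
    pairing_mul_self_nonneg hy (totalDegree_le_of_sum_mul_self hdq l)

/-- Jensen's inequality for SOS-convex polynomials: the vector `x` of first moments of `y`
satisfies `p(x) ≤ ⟨p, y⟩`. -/
theorem exists_eval_le_pairing {y : Tms n (2 * k)} (hy0 : y (zeroIdx n _) = 1)
    (hy : (momentMatrix y).PosSemidef) :
    ∃ x : Fin n → ℝ, ∀ p : MvPolynomial (Fin n) ℝ, IsSOSConvex p → p.totalDegree ≤ 2 * k →
      eval x p ≤ pairing p y := by
  -- For k = 0 there are no first moments, but p is constant and any point works.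
  rcases Nat.eq_zero_or_pos k with rfl | hk
  · refine ⟨0, fun p _ hdeg => ?_⟩
    rw [totalDegree_eq_zero_iff_eq_C.1 (Nat.le_zero.1 hdeg), pairing_C y hy0, eval_C]
  let e : Fin n → MultiIdx n (2 * k) := fun i =>
    ⟨Finsupp.single i 1, by rw [Finsupp.degree_single]; omega⟩
  refine ⟨fun i => y (e i), fun p hp hdeg => ?_⟩
  set x : Fin n → ℝ := fun i => y (e i) with hx
  set L := riesz y with hL
  have hLC : ∀ a, L (C a) = a := pairing_C y hy0
  have hLX : ∀ i, L (X i - C (x i)) = 0 := fun i => by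
    have h : L (X i) = x i :=
      (pairing_monomial y (e i) 1).trans (one_mul _)
    rw [map_sub, h, hLC, sub_self]
  have hφ := hasDerivAt_contract x p L
  have hφ' : Monotone fun t => L (∑ i, contract x t (pderiv i p) * (X i - C (x i))) := by
    refine monotone_of_hasDerivAt_nonneg (f' := fun t => L (∑ i, ∑ j,
      contract x t (pderiv j (pderiv i p)) * (X j - C (x j)) * (X i - C (x i)))) (fun t => ?_)
      fun t => pairing_hessian_nonneg hk hy hp hdeg x t
    simp only [map_sum]
    refine HasDerivAt.fun_sum fun i _ => ?_
    simpa [Finset.sum_mul] using hasDerivAt_contract x (pderiv i p)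
      (L ∘ₗ LinearMap.mulRight ℝ (X i - C (x i))) t
  -- At t = 0 the gradient is frozen at x, and L kills each `X i - C (x i)`.
  have hφ0 : L (∑ i, contract x 0 (pderiv i p) * (X i - C (x i))) = 0 := by
    simp [contract_zero, ← smul_eq_C_mul, hLX, -map_sub]
  have hmono : MonotoneOn (fun t => L (contract x t p)) (Set.Icc 0 1) := by
    refine monotoneOn_of_deriv_nonneg (convex_Icc 0 1)
      (fun t _ => (hφ t).continuousAt.continuousWithinAt)
      (fun t _ => (hφ t).differentiableAt.differentiableWithinAt) fun t ht => ?_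
    rw [interior_Icc] at ht
    rw [(hφ t).deriv, ← hφ0]
    exact hφ' ht.1.le
  have h := hmono (Set.left_mem_Icc.2 zero_le_one) (Set.right_mem_Icc.2 zero_le_one) zero_le_one
  simp only [contract_zero, contract_one, hLC] at h
  exact h

end Jensen

/-! ### Exactness of the relaxation and topology of the strict epigraph -/

section Relaxation

variable {n m : ℕ} {J : Type*}

/-- The vectors that are strictly larger than some objective vector over `K`. -/
def strictEpigraphSet (f : Fin m → MvPolynomial (Fin n) ℝ) (K : Set (Fin n → ℝ)) :
    Set (Fin m → ℝ) :=
  {v | ∃ x ∈ K, ∀ i, objective f x i < v i}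

theorem totalDegree_objective_le [Fintype J] (f : Fin m → MvPolynomial (Fin n) ℝ)
    (c : J → MvPolynomial (Fin n) ℝ) (i : Fin m) :
    (f i).totalDegree ≤ 2 * relaxOrder f c := by
  have h1 : (f i).totalDegree ≤ maxObjDegree f :=
    Finset.le_sup (f := fun i => (f i).totalDegree) (Finset.mem_univ i)
  have h2 : maxObjDegree f ⌈/⌉ 2 ≤ relaxOrder f c := le_max_left _ _
  rw [Nat.ceilDiv_eq_add_pred_div] at h2
  omega

theorem totalDegree_constraint_le [Fintype J] (f : Fin m → MvPolynomial (Fin n) ℝ)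
    (c : J → MvPolynomial (Fin n) ℝ) (j : J) :
    (c j).totalDegree ≤ 2 * relaxOrder f c := by
  have h : (c j).totalDegree ⌈/⌉ 2 ≤ relaxOrder f c :=
    (Finset.le_sup (f := fun j => (c j).totalDegree ⌈/⌉ 2) (Finset.mem_univ j)).trans
      (le_max_right _ _)
  rw [Nat.ceilDiv_eq_add_pred_div] at h
  omega

theorem sdpSet_eq_strictEpigraphSet [Fintype J] {f : Fin m → MvPolynomial (Fin n) ℝ}
    {c : J → MvPolynomial (Fin n) ℝ} (hf : ∀ i, IsSOSConvex (f i))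
    (hc : ∀ j, IsSOSConvex (-c j)) :
    sdpSet f c = strictEpigraphSet f (feasibleSet c) := by
  ext v
  constructor
  · rintro ⟨y, hyc, hyf, hy0, hy⟩
    obtain ⟨x, hx⟩ := exists_eval_le_pairing hy0 hy
    refine ⟨x, fun j => ?_, fun i =>
      (hx (f i) (hf i) (totalDegree_objective_le f c i)).trans_lt (hyf i)⟩
    have h := hx (-c j) (hc j) (by
      rw [totalDegree_neg]; exact totalDegree_constraint_le f c j)
    rw [← riesz_apply, map_neg, map_neg, riesz_apply] at h
    linarith [hyc j]
  · rintro ⟨x, hx, hxv⟩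
    refine ⟨diracTms _ x, fun j => ?_, fun i => ?_, ?_, posSemidef_momentMatrix_diracTms x⟩
    · rw [pairing_diracTms x (totalDegree_constraint_le f c j)]
      exact hx j
    · rw [pairing_diracTms x (totalDegree_objective_le f c i)]
      exact hxv i
    · simp [diracTms, zeroIdx]

theorem isOpen_strictEpigraphSet (f : Fin m → MvPolynomial (Fin n) ℝ) (K : Set (Fin n → ℝ)) :
    IsOpen (strictEpigraphSet f K) := by
  have h : strictEpigraphSet f K = ⋃ x ∈ K, ⋂ i, {v | objective f x i < v i} := by
    ext v
    simp [strictEpigraphSet]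
  rw [h]
  exact isOpen_biUnion fun x _ => isOpen_iInter_of_finite fun i =>
    isOpen_lt continuous_const (continuous_apply i)

/-- Every neighbourhood of `v` contains a point that is strictly below `v`. -/
theorem exists_forall_lt_of_mem_interior {S : Set (Fin m → ℝ)} {v : Fin m → ℝ}
    (hv : v ∈ interior S) : ∃ w ∈ S, ∀ i, w i < v i := by
  obtain ⟨ε, hε, hball⟩ := Metric.isOpen_iff.1 isOpen_interior v hv
  refine ⟨fun i => v i - ε / 2, interior_subset (hball ?_), fun i => by linarith⟩
  rw [Metric.mem_ball, dist_pi_lt_iff hε]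
  intro i
  rw [Real.dist_eq, sub_sub_cancel_left, abs_neg, abs_of_pos (half_pos hε)]
  exact half_lt_self hε

theorem interior_epigraphSet (f : Fin m → MvPolynomial (Fin n) ℝ) (K : Set (Fin n → ℝ)) :
    interior (epigraphSet f K) = strictEpigraphSet f K := by
  refine Set.Subset.antisymm (fun v hv => ?_)
    (interior_maximal (fun v ⟨x, hx, h⟩ => ⟨x, hx, fun i => (h i).le⟩)
      (isOpen_strictEpigraphSet f K))
  obtain ⟨w, ⟨x, hx, hxw⟩, hw⟩ := exists_forall_lt_of_mem_interior hv
  exact ⟨x, hx, fun i => (hxw i).trans_lt (hw i)⟩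

/-- Some w in the closure lies strictly below v; the open orthant below v then meets the set itself,
which is upward closed. -/
theorem interior_closure_strictEpigraphSet (f : Fin m → MvPolynomial (Fin n) ℝ)
    (K : Set (Fin n → ℝ)) :
    interior (closure (strictEpigraphSet f K)) = strictEpigraphSet f K := by
  refine Set.Subset.antisymm (fun v hv => ?_)
    (isOpen_strictEpigraphSet f K).subset_interior_closure
  obtain ⟨w, hw, hwv⟩ := exists_forall_lt_of_mem_interior hv
  have hopen : IsOpen {u : Fin m → ℝ | ∀ i, u i < v i} := by
    simp only [Set.ofPred_forall]
    exact isOpen_iInter_of_finite fun i => isOpen_lt (continuous_apply i) continuous_const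
  obtain ⟨u, huv, x, hx, hxu⟩ := mem_closure_iff.1 hw _ hopen hwv
  exact ⟨x, hx, fun i => (hxu i).trans (huv i)⟩

theorem objective_mem_closure_strictEpigraphSet (f : Fin m → MvPolynomial (Fin n) ℝ)
    {K : Set (Fin n → ℝ)} {x : Fin n → ℝ} (hx : x ∈ K) :
    objective f x ∈ closure (strictEpigraphSet f K) := by
  refine Metric.mem_closure_iff.2 fun ε hε =>
    ⟨fun i => objective f x i + ε / 2, ⟨x, hx, fun i => by linarith⟩, ?_⟩
  rw [dist_pi_lt_iff hε]
  intro i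
  rw [Real.dist_eq, sub_add_cancel_left, abs_neg, abs_of_pos (half_pos hε)]
  exact half_lt_self hε

theorem isWeaklyParetoValue_iff (f : Fin m → MvPolynomial (Fin n) ℝ) {K : Set (Fin n → ℝ)}
    {v : Fin m → ℝ} (hv : v ∈ objective f '' K) :
    IsWeaklyParetoValue f K v ↔ v ∉ strictEpigraphSet f K := by
  constructor
  · rintro ⟨p, ⟨-, hp⟩, rfl⟩ h
    exact hp h
  · obtain ⟨x, hx, rfl⟩ := hv
    exact fun h => ⟨x, ⟨hx, h⟩, rfl⟩

end Relaxation

end PolyMOP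

theorem theorem3p3 {n m : ℕ} {J : Type*} [Fintype J]
    (f : Fin m → MvPolynomial (Fin n) ℝ) (c : J → MvPolynomial (Fin n) ℝ)
    (hK : (interior (PolyMOP.feasibleSet c)).Nonempty)
    (hf : ∀ i, PolyMOP.IsSOSConvex (f i))
    (hc : ∀ j, PolyMOP.IsSOSConvex (-c j)) :
    interior (PolyMOP.epigraphSet f (PolyMOP.feasibleSet c)) = PolyMOP.sdpSet f c ∧
    ∀ v ∈ PolyMOP.objective f '' PolyMOP.feasibleSet c,
      (PolyMOP.IsWeaklyParetoValue f (PolyMOP.feasibleSet c) v ↔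
        v ∈ frontier (closure (PolyMOP.sdpSet f c))) := by
  rw [PolyMOP.sdpSet_eq_strictEpigraphSet hf hc]
  refine ⟨PolyMOP.interior_epigraphSet f _, fun v hv => ?_⟩
  -- The frontier of a closed set is the set minus its interior; values on K always lie in the
  -- closure, so only avoiding the interior matters.
  rw [PolyMOP.isWeaklyParetoValue_iff f hv, isClosed_closure.frontier_eq,
    PolyMOP.interior_closure_strictEpigraphSet]
  obtain ⟨x, hx, rfl⟩ := hv
  exact ⟨fun h => ⟨PolyMOP.objective_mem_closure_strictEpigraphSet f hx, h⟩, fun h => h.2⟩
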